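/- Let $E$ be a real normed space of finite dimension $d\ge 1$ with norm $|\cdot|$ (for instance $\mathbb{R}^d$ with an arbitrary norm), let $\lambda_d$ be Lebesgue measure (any Haar measure) on $E$, and let $B(x,t)$ be the ball with centre $x$ and radius $t$. Let $P=f\cdot\lambda_d$ be a probability measure on $E$ with Borel density $f:E\to[0,\infty)$, let $r,s>0$, and assume $\int |x|^{r+\eta}\,dP(x)<\infty$ for some $\eta>0$. Let $(\alpha_n)_{n\ge1}$ be an $L^r(P)$-optimal sequence of quantizers, i.e. for every $n\ge1$, $\alpha_n\subset E$ is nonempty with at most $n$ points and $$\int d(x,\alpha_n)^r\,dP(x)=\inf\Big\{\int d(x,\alpha)^r\,dP(x)\;:\;\emptyset\neq\alpha\subset E,\ \operatorname{card}\alpha\le n\Big\}.$$ For $b>0$ put $$\psi_b(x)=\sup_{n\ge1}\frac{\lambda_d\big(B(x,b\,d(x,\alpha_n))\big)}{P\big(B(x,b\,d(x,\alpha_n))\big)}\in[0,\infty].$$ (Here and below $a/0=\infty$ for $a>0$ and $0/0=0$.) Let $\theta>0$, $\mu\in E$, and let $P_{\theta,\mu}$ be the image of $P$ under $x\mapsto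 (x-\mu)/\theta+\mu$. Assume that $(\theta,\mu)$ is $P$-admissible, i.e. $\{f>0\}\subset \mu(1-\theta)+\theta\{f>0\}$ up to a $\lambda_d$-null set, and that * (H1) for every $M>0$, $\displaystyle\sup_{z\in B(0,M)}\frac{f(\mu+\theta(z-\mu))}{f(z)}\mathbf 1_{\{f(z)>0\}}<\infty$; * (H2) there are $b\in(0,1/2)$ and $M\in(0,\infty)$ with $\displaystyle\int_{B(0,M)^c}\Big(\sup_{0<t\le 2b|x|}\frac{\lambda_d(B(x,t))}{P(B(x,t))}\Big)^{s/(d+r)}dP_{\theta,\mu}(x)<\infty$. Consider further the hypothesis * (H3) $\lambda_d(\cdot\cap\operatorname{supp}P)\ll P$ and $\operatorname{supp}P$ is a finite union of closed convex sets. Then: (a) If $s\in(0,r+d)$, then $\psi_b^{s/(d+r)}\in L^1(P_{\theta,\mu})$ for some $b\in(0,1/2)$. (b) If $s\in(r+d,\infty)$, (H3) holds and $f^{-s/(r+d)}\in L^1_{\mathrm{loc}}(P)$, then $\psi_b^{s/(d+r)}\in L^1(P_{\theta,\mu})$ for some $b\in(0,1/2)$. -/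

import Mathlib

open MeasureTheory Set Module
open scoped ENNReal NNReal

noncomputable section

namespace Quantization

variable {E : Type*} [NormedAddCommGroup E] [NormedSpace ℝ E] [MeasurableSpace E]

/-- The `r`-th power `∫ d(x, α)^r dP(x)` of the `L^r(P)`-quantization error induced by the grid `α`
(only used for nonempty `α`). -/
def distortion (P : Measure E) (r : ℝ) (α : Finset E) : ℝ≥0∞ :=
  ∫⁻ x, ENNReal.ofReal (Metric.infDist x (α : Set E) ^ r) ∂P

/-- `e_{n,r}(P)^r`: the infimum of the distortion over all grids with at least one and at most
`n` points. -/
def optimalDistortion (P : Measure E) (r : ℝ) (n : ℕ) : ℝ≥0∞ :=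
  ⨅ (α : Finset E) (_ : α.Nonempty) (_ : α.card ≤ n), distortion P r α

/-- `(α_n)_{n ≥ 1}` is an `L^r(P)`-optimal sequence of quantizers; the value `α 0` is irrelevant. -/
def IsOptimalSeq (P : Measure E) (r : ℝ) (α : ℕ → Finset E) : Prop :=
  ∀ n, 1 ≤ n → (α n).Nonempty ∧ (α n).card ≤ n ∧ distortion P r (α n) = optimalDistortion P r n

/-- The ratio `lam (B(x,t)) / P (B(x,t))`, with value `∞` if only the denominator vanishes. -/
def ballRatio (lam P : Measure E) (x : E) (t : ℝ) : ℝ≥0∞ :=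
  lam (Metric.closedBall x t) / P (Metric.closedBall x t)

/-- The maximal function `ψ_b` attached to the sequence `(α_n)_{n ≥ 1}`. -/
def maximalFunction (lam P : Measure E) (α : ℕ → Finset E) (b : ℝ) (x : E) : ℝ≥0∞ :=
  ⨆ (n : ℕ) (_ : 1 ≤ n), ballRatio lam P x (b * Metric.infDist x (α n : Set E))

/-- `P_{θ,μ}`: the image of `P` under `x ↦ (x - μ) / θ + μ`. -/
def scaledLaw (P : Measure E) (θ : ℝ) (μ : E) : Measure E :=
  P.map (fun x => θ⁻¹ • (x - μ) + μ)

/-- `(θ, μ)` is admissible for `P = f · lam`: up to a `lam`-null set, `{f > 0}` is contained in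
`μ (1 - θ) + θ {f > 0}`. -/
def Admissible (lam : Measure E) (f : E → ℝ≥0) (θ : ℝ) (μ : E) : Prop :=
  ∀ᵐ x ∂lam, x ∈ {y | 0 < f y} → x ∈ (fun y => (1 - θ) • μ + θ • y) '' {y | 0 < f y}

/-- Hypothesis (H1). -/
def H1 (f : E → ℝ≥0) (θ : ℝ) (μ : E) : Prop :=
  ∀ M : ℝ, 0 < M → BddAbove
    ({z | 0 < f z}.indicator (fun z => f (μ + θ • (z - μ)) / f z) '' Metric.closedBall 0 M)

/-- Hypothesis (H2). -/
def H2 (lam P : Measure E) (r s θ : ℝ) (μ : E) : Prop :=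
  ∃ b ∈ Ioo (0 : ℝ) (1 / 2), ∃ M : ℝ, 0 < M ∧
    ∫⁻ x in (Metric.closedBall 0 M)ᶜ,
      (⨆ t ∈ Ioc (0 : ℝ) (2 * b * ‖x‖), ballRatio lam P x t) ^ (s / (finrank ℝ E + r))
      ∂(scaledLaw P θ μ) < ∞

/-- Hypothesis (H3). -/
def H3 (lam P : Measure E) : Prop :=
  lam.restrict P.support ≪ P ∧
    ∃ 𝒞 : Set (Set E), 𝒞.Finite ∧ (∀ C ∈ 𝒞, IsClosed C ∧ Convex ℝ C) ∧ P.support = ⋃₀ 𝒞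

/-- The integrability assumption on the maximal function:
`ψ_b^{s/(d+r)} ∈ L^1(P_{θ,μ})` for some `b ∈ (0, 1/2)`. -/
def MaximalIntegrability (lam P : Measure E) (r s θ : ℝ) (μ : E) (α : ℕ → Finset E) : Prop :=
  ∃ b ∈ Ioo (0 : ℝ) (1 / 2),
    Integrable (fun x => maximalFunction lam P α b x ^ (s / (finrank ℝ E + r))) (scaledLaw P θ μ)

end Quantization

end

noncomputable section

/-! ### Weak type inequality and dyadic integral bounds -/

namespace Quantization

/-! Put `p = s/(d+r)`. Comparison with the grid `{0}` keeps the optimal grids within a fixed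
distance `K` of the origin, so `b * d(x, α_n) ≤ b * (K + ‖x‖)`. For large `‖x‖` and small `b` these
radii fall in the range of (H2), which settles the complement of a ball. On the ball, (H1) and
admissibility dominate the dilated law by a multiple of `P`, and the radii are at most some `T`. It
remains to integrate `ψ_b ^ p` over balls against `P` itself (`maximalIntegrability_of_local`).

There `ψ_b` is dominated by a centred maximal function relative to `P`. Since `P` need not be
doubling, the weak type bound comes from Besicovitch covering (`exists_weak_type_const`). For `p <
1`, the bound with `lam` on a larger ball is enough: a weak L¹ function on a finite measure space
has integrable powers below one. For `p > 1`, convexity of the pieces of the support gives `lam B ≤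
c * lam (B ∩ supp P)`, and absolute continuity turns this into `lam B ≤ ∫_B c / f dP`. So `ψ_b` is
at most the maximal function of `c / f`, and a Marcinkiewicz truncation bounds its `p`-th moment by
that of `1 / f`. -/

/-- Weak type estimate from the Besicovitch covering theorem, for arbitrary measures `P`, `ν`. -/
theorem exists_weak_type_const (E : Type*) [NormedAddCommGroup E] [NormedSpace ℝ E]
    [FiniteDimensional ℝ E] [MeasurableSpace E] [BorelSpace E] :
    ∃ N : ℕ, ∀ (P ν : Measure E) (A : Set E) (T : ℝ) (τ : ℝ≥0∞),
      (∀ x ∈ A, ∃ t ∈ Ioc 0 T,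
        τ * P (Metric.closedBall x t) ≤ ν (Metric.closedBall x t)) →
      τ * P A ≤ N * ν univ := by
  obtain ⟨N, σ, hσ, hN⟩ := HasBesicovitchCovering.no_satelliteConfig (α := E)
  refine ⟨N, fun P ν A T τ h => ?_⟩
  choose! t ht hle using h
  let q : Besicovitch.BallPackage A E :=
    { c := fun x => x, r := fun x => t x, rpos := fun x => (ht x x.2).1, r_bound := T,
      r_le := fun x => (ht x x.2).2 }
  obtain ⟨u, hu, hcov⟩ := Besicovitch.exist_disjoint_covering_families hσ hN q
  have hcount : ∀ i, (u i).Countable := fun i =>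
    (hu i).countable_of_nonempty_interior fun j _ => by
      refine ⟨j, ?_⟩
      exact Metric.ball_subset_interior_closedBall (Metric.mem_ball_self (q.rpos j))
  have hA : A ⊆ ⋃ i, ⋃ j ∈ u i, Metric.closedBall (q.c j) (q.r j) := by
    intro x hx
    have hx' := hcov ⟨⟨x, hx⟩, rfl⟩
    simp only [mem_iUnion] at hx' ⊢
    obtain ⟨i, j, hj, hxj⟩ := hx'
    exact ⟨i, j, hj, Metric.ball_subset_closedBall hxj⟩
  have hfam : ∀ i, τ * P (⋃ j ∈ u i, Metric.closedBall (q.c j) (q.r j)) ≤ ν univ := by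
    intro i
    rw [measure_biUnion (hcount i) (hu i) fun j _ => Metric.isClosed_closedBall.measurableSet,
      ← ENNReal.tsum_mul_left]
    calc ∑' j : u i, τ * P (Metric.closedBall (q.c j) (q.r j))
        ≤ ∑' j : u i, ν (Metric.closedBall (q.c j) (q.r j)) :=
          ENNReal.tsum_le_tsum fun j => hle _ j.1.2
      _ = ν (⋃ j ∈ u i, Metric.closedBall (q.c j) (q.r j)) :=
          (measure_biUnion (hcount i) (hu i)
            fun j _ => Metric.isClosed_closedBall.measurableSet).symm
      _ ≤ ν univ := measure_mono (subset_univ _)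
  calc τ * P A ≤ τ * ∑ i, P (⋃ j ∈ u i, Metric.closedBall (q.c j) (q.r j)) := by
        gcongr
        exact (measure_mono hA).trans (measure_iUnion_fintype_le _ _)
    _ = ∑ i, τ * P (⋃ j ∈ u i, Metric.closedBall (q.c j) (q.r j)) := Finset.mul_sum _ _ _
    _ ≤ ∑ _i : Fin N, ν univ := Finset.sum_le_sum fun i _ => hfam i
    _ = N * ν univ := by simp

theorem rpow_le_one_add_tsum_dyadic {p : ℝ} (hp : 0 < p) (x : ℝ≥0∞) :
    x ^ p ≤ 1 + ∑' k : ℕ, ((2 : ℝ≥0∞) ^ (k + 1)) ^ p * {y : ℝ≥0∞ | 2 ^ k < y}.indicator 1 x := by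
  classical
  by_cases h1 : x ≤ 1
  · exact (ENNReal.rpow_le_one h1 hp.le).trans le_self_add
  refine le_trans ?_ le_add_self
  by_cases hx : x = ∞
  -- At `∞` no indicator vanishes and every term is at least 1, so the series diverges.
  · have : ∀ k : ℕ, (1 : ℝ≥0∞) ≤
        ((2 : ℝ≥0∞) ^ (k + 1)) ^ p * {y : ℝ≥0∞ | 2 ^ k < y}.indicator 1 x := by
      intro k
      have hk : x ∈ {y : ℝ≥0∞ | 2 ^ k < y} := by
        simp only [hx, mem_ofPred_eq]
        exact ENNReal.pow_lt_top (by simp)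
      rw [indicator_of_mem hk, Pi.one_apply, mul_one]
      exact ENNReal.one_le_rpow (one_le_pow₀ one_le_two) hp
    have h := ENNReal.tsum_le_tsum this
    rw [ENNReal.tsum_const_eq_top_of_ne_zero one_ne_zero] at h
    exact le_top.trans h
  have hex : ∃ m : ℕ, x ≤ 2 ^ m := by
    obtain ⟨m, hm⟩ := ENNReal.exists_nat_gt hx
    refine ⟨m, hm.le.trans ?_⟩
    exact_mod_cast Nat.lt_two_pow_self.le
  have hm := Nat.find_spec hex
  have hm0 : Nat.find hex ≠ 0 := by
    intro h0
    rw [h0, pow_zero] at hm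
    exact h1 hm
  obtain ⟨k, hk⟩ := Nat.exists_eq_succ_of_ne_zero hm0
  have hlt : 2 ^ k < x := not_le.1 (Nat.find_min hex (m := k) (by omega))
  refine le_trans ?_ (ENNReal.le_tsum k)
  rw [indicator_of_mem (show x ∈ {y : ℝ≥0∞ | 2 ^ k < y} from hlt), Pi.one_apply, mul_one]
  rw [hk] at hm
  exact ENNReal.rpow_le_rpow hm hp.le

theorem lintegral_rpow_le_tsum_dyadic {X : Type*} [MeasurableSpace X] (ν : Measure X)
    {ψ : X → ℝ≥0∞} (hψ : Measurable ψ) {p : ℝ} (hp : 0 < p) :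
    ∫⁻ x, ψ x ^ p ∂ν ≤
      ν univ + ∑' k : ℕ, ((2 : ℝ≥0∞) ^ (k + 1)) ^ p * ν {x | 2 ^ k < ψ x} := by
  have hm : ∀ k : ℕ, Measurable fun x => {y : ℝ≥0∞ | 2 ^ k < y}.indicator (1 : ℝ≥0∞ → ℝ≥0∞) (ψ x) :=
    fun k => (measurable_one.indicator measurableSet_Ioi).comp hψ
  calc ∫⁻ x, ψ x ^ p ∂ν
      ≤ ∫⁻ x, (1 + ∑' k : ℕ, ((2 : ℝ≥0∞) ^ (k + 1)) ^ p *
          {y : ℝ≥0∞ | 2 ^ k < y}.indicator 1 (ψ x)) ∂ν :=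
        lintegral_mono fun x => rpow_le_one_add_tsum_dyadic hp _
    _ = _ := by
        rw [lintegral_add_left measurable_const, lintegral_one,
          lintegral_tsum fun k => ((hm k).const_mul _).aemeasurable]
        congr 2
        ext k
        rw [lintegral_const_mul _ (hm k)]
        congr 1
        rw [← lintegral_indicator_one (measurableSet_lt measurable_const hψ)]
        rfl

/-- Splits off one factor `2 ^ k`, to be paired with the level-set measure in a weak type bound. -/
theorem two_pow_succ_rpow (p : ℝ) (k : ℕ) :
    ((2 : ℝ≥0∞) ^ (k + 1)) ^ p = 2 ^ p * (2 ^ k * ((2 : ℝ≥0∞) ^ k) ^ (p - 1)) := by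
  have h2 : ((2 : ℝ≥0∞) ^ k) ≠ 0 := by simp
  have h2' : ((2 : ℝ≥0∞) ^ k) ≠ ∞ := by simp
  rw [pow_succ', ENNReal.mul_rpow_of_ne_top (by simp) h2']
  congr 1
  conv_rhs => rw [← ENNReal.rpow_one ((2 : ℝ≥0∞) ^ k), ← ENNReal.rpow_mul,
    ← ENNReal.rpow_add _ _ h2 h2']
  congr 1
  ring

/-- The dyadic series is dominated by a geometric one of ratio `2 ^ (p - 1) < 1`. -/
theorem lintegral_rpow_lt_top_of_weak_type {X : Type*} [MeasurableSpace X] (ν : Measure X)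
    [IsFiniteMeasure ν] {ψ : X → ℝ≥0∞} (hψ : Measurable ψ) {p : ℝ} (hp : 0 < p) (hp1 : p < 1)
    {C : ℝ≥0∞} (hC : C ≠ ∞) (h : ∀ k : ℕ, 2 ^ k * ν {x | 2 ^ k < ψ x} ≤ C) :
    ∫⁻ x, ψ x ^ p ∂ν < ∞ := by
  refine (lintegral_rpow_le_tsum_dyadic ν hψ hp).trans_lt ?_
  refine ENNReal.add_lt_top.2 ⟨measure_lt_top _ _, ?_⟩
  have ha : (2 : ℝ≥0∞) ^ (p - 1) < 1 :=
    ENNReal.rpow_lt_one_of_one_lt_of_neg (by simp) (by linarith)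
  calc ∑' k : ℕ, ((2 : ℝ≥0∞) ^ (k + 1)) ^ p * ν {x | 2 ^ k < ψ x}
      ≤ ∑' k : ℕ, (2 ^ p * C) * ((2 : ℝ≥0∞) ^ (p - 1)) ^ k := by
        refine ENNReal.tsum_le_tsum fun k => ?_
        rw [two_pow_succ_rpow, ← ENNReal.rpow_natCast_mul, mul_comm (k : ℝ),
          ENNReal.rpow_mul_natCast]
        calc _ = 2 ^ p * (2 ^ k * ν {x | 2 ^ k < ψ x}) * ((2 : ℝ≥0∞) ^ (p - 1)) ^ k := by ring
          _ ≤ _ := by gcongr; exact h k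
    _ < ∞ := by
        rw [ENNReal.tsum_mul_left, ENNReal.tsum_geometric]
        refine ENNReal.mul_lt_top (ENNReal.mul_lt_top
          (ENNReal.rpow_lt_top_of_nonneg hp.le (by simp)) hC.lt_top) ?_
        exact ENNReal.inv_lt_top.2 (tsub_pos_of_lt ha)

/-- A growing geometric sum is comparable to its last term, and the indicator stops it before `2 ^
k` reaches `y`. -/
theorem exists_tsum_dyadic_le {q : ℝ} (hq : 0 < q) :
    ∃ A : ℝ≥0∞, A ≠ ∞ ∧ ∀ y : ℝ≥0∞,
      ∑' k : ℕ, ((2 : ℝ≥0∞) ^ k) ^ q * {z : ℝ≥0∞ | 2 ^ k < z}.indicator 1 y ≤ A * y ^ q := by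
  classical
  set a : ℝ≥0∞ := 2 ^ q with ha
  have ha1 : 1 < a := ENNReal.one_lt_rpow (by simp) hq
  have hatop : a ≠ ∞ := (ENNReal.rpow_lt_top_of_nonneg hq.le (by simp)).ne
  have ha0 : a ≠ 0 := (zero_lt_one.trans ha1).ne'
  have hak : ∀ k : ℕ, ((2 : ℝ≥0∞) ^ k) ^ q = a ^ k := fun k => by
    rw [← ENNReal.rpow_natCast_mul, mul_comm (k : ℝ), ENNReal.rpow_mul_natCast]
  set A : ℝ≥0∞ := ∑' j : ℕ, a⁻¹ ^ j with hA
  have hAstep : 1 + A * a⁻¹ = A := by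
    conv_rhs => rw [hA, tsum_eq_zero_add' ENNReal.summable]
    simp only [pow_zero, pow_succ]
    rw [ENNReal.tsum_mul_right]
  have hgeo : ∀ n : ℕ, ∑ k ∈ Finset.range (n + 1), a ^ k ≤ A * a ^ n := by
    intro n
    induction n with
    | zero =>
      simp only [zero_add, Finset.range_one, Finset.sum_singleton, pow_zero, mul_one]
      rw [← hAstep]
      exact le_self_add
    | succ n ih =>
      rw [Finset.sum_range_succ]
      calc _ ≤ A * a ^ n + a ^ (n + 1) := by gcongr
        _ = (1 + A * a⁻¹) * a ^ (n + 1) := by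
          rw [add_mul, one_mul, pow_succ', mul_assoc A, ← mul_assoc a⁻¹,
            ENNReal.inv_mul_cancel ha0 hatop, one_mul, add_comm]
        _ = A * a ^ (n + 1) := by rw [hAstep]
  refine ⟨A, ?_, fun y => ?_⟩
  · rw [hA, ENNReal.tsum_geometric]
    exact ENNReal.inv_ne_top.2 (tsub_pos_of_lt (ENNReal.inv_lt_one.2 ha1)).ne'
  refine ENNReal.tsum_le_of_sum_range_le fun n => ?_
  induction n with
  | zero => simp
  | succ n ih =>
    by_cases hn : 2 ^ n < y
    · calc _ ≤ ∑ k ∈ Finset.range (n + 1), a ^ k := by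
            refine Finset.sum_le_sum fun k _ => ?_
            rw [hak]
            exact mul_le_of_le_one_right zero_le (indicator_le_self' (by simp) _)
        _ ≤ A * a ^ n := hgeo n
        _ ≤ A * y ^ q := by
            rw [← hak]
            gcongr
    · rw [Finset.sum_range_succ, indicator_of_notMem (by simpa using hn), mul_zero, add_zero]
      exact ih

/-- Exchanging sum and integral leaves `H` times the sum of `2 ^ (k (p - 1))` over `2 ^ k < H`,
which is of order `H ^ p`. -/
theorem lintegral_rpow_lt_top_of_strong_type {X : Type*} [MeasurableSpace X] (ν P : Measure X)
    [IsFiniteMeasure ν] {ψ H : X → ℝ≥0∞} (hψ : Measurable ψ) (hH : Measurable H) {p : ℝ}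
    (hp : 1 < p) {C : ℝ≥0∞} (hC : C ≠ ∞) (hHp : ∫⁻ x, H x ^ p ∂P < ∞)
    (h : ∀ k : ℕ, 2 ^ k * ν {x | 2 ^ k < ψ x} ≤ C * ∫⁻ x in {x | 2 ^ k < H x}, H x ∂P) :
    ∫⁻ x, ψ x ^ p ∂ν < ∞ := by
  have hp0 : 0 < p := by linarith
  refine (lintegral_rpow_le_tsum_dyadic ν hψ hp0).trans_lt ?_
  refine ENNReal.add_lt_top.2 ⟨measure_lt_top _ _, ?_⟩
  obtain ⟨A, hA, hAle⟩ := exists_tsum_dyadic_le (show 0 < p - 1 by linarith)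
  have hm : ∀ k : ℕ, Measurable fun x => {y : ℝ≥0∞ | 2 ^ k < y}.indicator (1 : ℝ≥0∞ → ℝ≥0∞) (H x) :=
    fun k => (measurable_one.indicator measurableSet_Ioi).comp hH
  have hset : ∀ k : ℕ, ∫⁻ x in {x | 2 ^ k < H x}, H x ∂P =
      ∫⁻ x, H x * {y : ℝ≥0∞ | 2 ^ k < y}.indicator 1 (H x) ∂P := by
    intro k
    rw [← lintegral_indicator (measurableSet_lt measurable_const hH)]
    refine lintegral_congr fun x => ?_
    by_cases hx : 2 ^ k < H x
    · rw [indicator_of_mem (by exact hx), indicator_of_mem (by exact hx), Pi.one_apply, mul_one]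
    · rw [indicator_of_notMem (by exact hx), indicator_of_notMem (by exact hx), mul_zero]
  calc ∑' k : ℕ, ((2 : ℝ≥0∞) ^ (k + 1)) ^ p * ν {x | 2 ^ k < ψ x}
      ≤ ∑' k : ℕ, (2 ^ p * C) * ∫⁻ x, H x *
          (((2 : ℝ≥0∞) ^ k) ^ (p - 1) * {y : ℝ≥0∞ | 2 ^ k < y}.indicator 1 (H x)) ∂P := by
        refine ENNReal.tsum_le_tsum fun k => ?_
        have e : ∫⁻ x, H x * (((2 : ℝ≥0∞) ^ k) ^ (p - 1) *
            {y : ℝ≥0∞ | 2 ^ k < y}.indicator 1 (H x)) ∂P =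
            ((2 : ℝ≥0∞) ^ k) ^ (p - 1) * ∫⁻ x in {x | 2 ^ k < H x}, H x ∂P := by
          rw [hset, ← lintegral_const_mul _ (by exact hH.mul (hm k))]
          exact lintegral_congr fun x => by ring
        rw [e, two_pow_succ_rpow]
        calc _ = 2 ^ p * ((2 : ℝ≥0∞) ^ k) ^ (p - 1) * (2 ^ k * ν {x | 2 ^ k < ψ x}) := by ring
          _ ≤ 2 ^ p * ((2 : ℝ≥0∞) ^ k) ^ (p - 1) * (C * ∫⁻ x in {x | 2 ^ k < H x}, H x ∂P) := by
              exact mul_le_mul_right (h k) _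
          _ = _ := by ring
    _ = (2 ^ p * C) * ∫⁻ x, H x * ∑' k : ℕ, (((2 : ℝ≥0∞) ^ k) ^ (p - 1) *
          {y : ℝ≥0∞ | 2 ^ k < y}.indicator 1 (H x)) ∂P := by
        rw [ENNReal.tsum_mul_left, ← lintegral_tsum
          fun k => by exact (hH.mul ((hm k).const_mul _)).aemeasurable]
        simp_rw [ENNReal.tsum_mul_left]
    _ ≤ (2 ^ p * C) * ∫⁻ x, A * H x ^ p ∂P := by
        refine mul_le_mul_right (lintegral_mono fun x => ?_) _
        calc _ ≤ H x * (A * H x ^ (p - 1)) := mul_le_mul_right (hAle _) _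
          _ = A * (H x ^ (1 : ℝ) * H x ^ (p - 1)) := by rw [ENNReal.rpow_one]; ring
          _ = A * H x ^ p := by
              rw [← ENNReal.rpow_add_of_nonneg _ _ zero_le_one (by linarith)]
              congr 2
              ring
    _ < ∞ := by
        rw [lintegral_const_mul _ (hH.pow_const p)]
        exact ENNReal.mul_lt_top (ENNReal.mul_lt_top
          (ENNReal.rpow_lt_top_of_nonneg hp0.le (by simp)) hC.lt_top)
          (ENNReal.mul_lt_top hA.lt_top hHp)

/-! ### Local integrability of the maximal function -/

section Maximal

variable {E : Type*} [NormedAddCommGroup E] [NormedSpace ℝ E] [FiniteDimensional ℝ E]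
  [MeasurableSpace E] [BorelSpace E]

theorem measurable_measure_closedBall (ν : Measure E) [SFinite ν] {ρ : E → ℝ} (hρ : Continuous ρ) :
    Measurable fun x => ν (Metric.closedBall x (ρ x)) := by
  -- The balls are the sections of one closed subset of `E × E`.
  have hc : IsClosed {z : E × E | dist z.2 z.1 ≤ ρ z.1} :=
    isClosed_le (continuous_snd.dist continuous_fst) (hρ.comp continuous_fst)
  exact measurable_measure_prodMk_left hc.measurableSet

theorem measurable_maximalFunction (lam P : Measure E) [SFinite lam] [SFinite P]
    (α : ℕ → Finset E) (b : ℝ) : Measurable (maximalFunction lam P α b) := by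
  refine Measurable.iSup fun n => Measurable.iSup fun _ => ?_
  have hc : Continuous fun x : E => b * Metric.infDist x (α n : Set E) :=
    continuous_const.mul (Metric.continuous_infDist_pt _)
  exact (measurable_measure_closedBall lam hc).div (measurable_measure_closedBall P hc)

/-- A point is `lam`-null in a nontrivial space, and `0 / a = 0` also for `a = 0`. Degenerate balls
thus never matter, while the covering theorem requires positive radii. -/
theorem ballRatio_zero [Nontrivial E] (lam P : Measure E) [lam.IsAddHaarMeasure] (x : E) :
    ballRatio lam P x 0 = 0 := by
  simp [ballRatio]

theorem exists_radius_of_lt_maximalFunction [Nontrivial E] (lam P : Measure E)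
    [lam.IsAddHaarMeasure] {α : ℕ → Finset E} {b T : ℝ} (hb : 0 ≤ b) {x : E}
    (hT : ∀ n, 1 ≤ n → b * Metric.infDist x (α n : Set E) ≤ T) {τ : ℝ≥0∞}
    (h : τ < maximalFunction lam P α b x) :
    ∃ t ∈ Ioc 0 T, τ * P (Metric.closedBall x t) ≤ lam (Metric.closedBall x t) := by
  simp only [maximalFunction, lt_iSup_iff] at h
  obtain ⟨n, hn, h⟩ := h
  refine ⟨_, ⟨(mul_nonneg hb Metric.infDist_nonneg).lt_of_ne' fun h0 => ?_, hT n hn⟩,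
    ENNReal.mul_le_of_le_div h.le⟩
  rw [h0, ballRatio_zero] at h
  exact not_lt_zero h

theorem lintegral_maximalFunction_lt_top_of_lt_one [Nontrivial E] (lam P : Measure E)
    [lam.IsAddHaarMeasure] [IsFiniteMeasure P] {α : ℕ → Finset E} {b T M p : ℝ} (hb : 0 ≤ b)
    (hT : ∀ x ∈ Metric.closedBall (0 : E) M, ∀ n, 1 ≤ n → b * Metric.infDist x (α n : Set E) ≤ T)
    (hp : 0 < p) (hp1 : p < 1) :
    ∫⁻ x in Metric.closedBall 0 M, maximalFunction lam P α b x ^ p ∂P < ∞ := by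
  obtain ⟨N, hN⟩ := exists_weak_type_const E
  have hψ := measurable_maximalFunction lam P α b
  refine lintegral_rpow_lt_top_of_weak_type _ hψ hp hp1
    -- Balls of radius at most `T` centred in the `M`-ball stay in the ball of radius `M + T`, whose
    -- `lam`-measure is finite.
    (C := N * lam.restrict (Metric.closedBall 0 (M + T)) univ) ?_ fun k => ?_
  · rw [Measure.restrict_apply_univ]
    exact ENNReal.mul_ne_top (ENNReal.natCast_ne_top N)
      (isCompact_closedBall _ _).measure_lt_top.ne
  · rw [Measure.restrict_apply (measurableSet_lt measurable_const hψ)]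
    refine hN _ _ _ T _ ?_
    rintro x ⟨hx, hxM⟩
    obtain ⟨t, ht, hle⟩ := exists_radius_of_lt_maximalFunction lam P hb (hT x hxM) hx
    refine ⟨t, ht, hle.trans ?_⟩
    rw [Measure.restrict_eq_self _ (Metric.closedBall_subset_closedBall' ?_)]
    have := Metric.mem_closedBall.1 hxM
    linarith [ht.2]

/-- The case `p > 1`: a Marcinkiewicz type argument for the maximal function of `h` relative
to `P`. -/
theorem lintegral_maximalFunction_lt_top_of_one_lt [Nontrivial E] (lam P : Measure E)
    [lam.IsAddHaarMeasure] [IsFiniteMeasure P] {α : ℕ → Finset E} {b T M p : ℝ} (hb : 0 ≤ b)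
    (hT : ∀ x ∈ Metric.closedBall (0 : E) M, ∀ n, 1 ≤ n → b * Metric.infDist x (α n : Set E) ≤ T)
    (hp : 1 < p) {h : E → ℝ≥0∞} (hh : Measurable h)
    (hhp : ∫⁻ x in Metric.closedBall 0 (M + T), h x ^ p ∂P < ∞)
    (hle : ∀ᵐ x ∂P, x ∈ Metric.closedBall 0 M → ∀ t ∈ Ioc 0 T,
      lam (Metric.closedBall x t) ≤ ∫⁻ y in Metric.closedBall x t, h y ∂P) :
    ∫⁻ x in Metric.closedBall 0 M, maximalFunction lam P α b x ^ p ∂P < ∞ := by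
  obtain ⟨N, hN⟩ := exists_weak_type_const E
  have hψ := measurable_maximalFunction lam P α b
  have hH : Measurable fun x => 2 * h x := hh.const_mul 2
  refine lintegral_rpow_lt_top_of_strong_type (P.restrict (Metric.closedBall 0 M))
    (P.restrict (Metric.closedBall 0 (M + T))) hψ hH hp (ENNReal.natCast_ne_top N) ?_ fun k => ?_
  · simp_rw [ENNReal.mul_rpow_of_nonneg _ _ (show 0 ≤ p by linarith)]
    rw [lintegral_const_mul _ (hh.pow_const p)]
    exact ENNReal.mul_lt_top (ENNReal.rpow_lt_top_of_nonneg (by linarith) (by simp)) hhp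
  set B' := Metric.closedBall (0 : E) (M + T)
  set S : Set E := {x | 2 ^ k < 2 * h x} with hS
  have hSm : MeasurableSet S := measurableSet_lt measurable_const hH
  -- Truncation: only the part of `2 * h` above the level `2 ^ k` enters the covering estimate.
  set ν : Measure E := ((P.restrict B').restrict S).withDensity (fun x => 2 * h x) with hν
  have hνuniv : ν univ = ∫⁻ x in S, 2 * h x ∂(P.restrict B') := by
    rw [hν, withDensity_apply _ MeasurableSet.univ, Measure.restrict_univ]
  rw [← hνuniv, Measure.restrict_apply (measurableSet_lt measurable_const hψ)]
  set G : Set E := {x | x ∈ Metric.closedBall 0 M → ∀ t ∈ Ioc 0 T,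
      lam (Metric.closedBall x t) ≤ ∫⁻ y in Metric.closedBall x t, h y ∂P} with hG
  have hGae : P Gᶜ = 0 := hle
  rw [← measure_inter_conull hGae]
  refine hN _ _ _ T _ ?_
  rintro x ⟨⟨hx, hxM⟩, hxG⟩
  obtain ⟨t, ht, htle⟩ := exists_radius_of_lt_maximalFunction lam P hb (hT x hxM) hx
  refine ⟨t, ht, ?_⟩
  set B := Metric.closedBall x t
  have hBm : MeasurableSet B := Metric.isClosed_closedBall.measurableSet
  have hBB' : B ⊆ B' := Metric.closedBall_subset_closedBall' (by
    have := Metric.mem_closedBall.1 hxM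
    linarith [ht.2])
  have hνB : ν B = ∫⁻ y in B ∩ S, 2 * h y ∂P := by
    rw [hν, withDensity_apply _ hBm, Measure.restrict_restrict hBm,
      Measure.restrict_restrict (hBm.inter hSm), inter_eq_left.2 (inter_subset_left.trans hBB')]
  have h1 : 2 ^ k * P B ≤ ∫⁻ y in B, h y ∂P := htle.trans (hxG hxM t ht)
  -- Off `S` the integrand is at most `2 ^ k`, which costs one `2 ^ k * P B`. The factor 2 supplies
  -- a second copy, so one survives the cancellation below.
  have h2 : 2 * ∫⁻ y in B, h y ∂P ≤ ν B + 2 ^ k * P B := by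
    rw [← lintegral_const_mul _ hh, ← lintegral_inter_add_sdiff _ B hSm, hνB]
    gcongr
    calc ∫⁻ y in B \ S, 2 * h y ∂P ≤ ∫⁻ _ in B \ S, 2 ^ k ∂P :=
          setLIntegral_mono measurable_const fun y hy => not_lt.1 hy.2
      _ = 2 ^ k * P (B \ S) := setLIntegral_const _ _
      _ ≤ 2 ^ k * P B := by
        gcongr
        exact sdiff_subset
  have h3 : 2 ^ k * P B + 2 ^ k * P B ≤ ν B + 2 ^ k * P B := by
    rw [← two_mul]
    exact (mul_le_mul_right h1 2).trans h2
  exact (ENNReal.add_le_add_iff_right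
    (ENNReal.mul_ne_top (by simp) (measure_ne_top _ _))).1 h3

end Maximal

/-! ### Volume of balls inside convex sets and supports -/

section Geometry

variable {E : Type*} [NormedAddCommGroup E] [NormedSpace ℝ E] [FiniteDimensional ℝ E]
  [MeasurableSpace E] [BorelSpace E]

/-- Shrinking a fixed bounded piece `D` of `C` towards `x` keeps it in `C` by convexity and, at
ratio `t / L`, puts it in the ball. Its volume scales like `t ^ d`, as does that of the ball. -/
theorem exists_measure_closedBall_le_of_convex (lam : Measure E) [lam.IsAddHaarMeasure]
    {C : Set E} (hC : Convex ℝ C) (hpos : lam C ≠ 0) {M : ℝ} (hM : 0 ≤ M) (T : ℝ) :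
    ∃ c : ℝ≥0∞, c ≠ ∞ ∧ ∀ x ∈ C ∩ Metric.closedBall 0 M, ∀ t ∈ Ioc 0 T,
      lam (Metric.closedBall x t) ≤ c * lam (Metric.closedBall x t ∩ C) := by
  obtain ⟨n, hn⟩ : ∃ n : ℕ, lam (C ∩ Metric.closedBall 0 n) ≠ 0 := by
    by_contra! h
    refine hpos ?_
    rw [← inter_univ C, ← Metric.iUnion_closedBall_nat (0 : E), inter_iUnion]
    exact measure_iUnion_null h
  set D := C ∩ Metric.closedBall (0 : E) n
  have hD : lam D ≠ ∞ :=
    ((measure_mono inter_subset_right).trans_lt (isCompact_closedBall _ _).measure_lt_top).ne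
  -- `L` bounds both the distance from `x` to points of `D` and the radius `t`, so the ratio `t / L`
  -- is at most 1.
  set L : ℝ := M + n + T with hL
  set d := finrank ℝ E
  refine ⟨ENNReal.ofReal (L ^ d) * lam (Metric.closedBall 0 1) / lam D,
    ENNReal.div_ne_top (ENNReal.mul_ne_top ENNReal.ofReal_ne_top
      (isCompact_closedBall _ _).measure_lt_top.ne) hn, ?_⟩
  rintro x ⟨hxC, hxM⟩ t ht
  have hL0 : 0 < L := by
    have : (0 : ℝ) ≤ n := Nat.cast_nonneg n
    linarith [ht.1, ht.2]
  have hε0 : 0 ≤ t / L := div_nonneg ht.1.le hL0.le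
  have hε1 : t / L ≤ 1 := by
    rw [div_le_one hL0]
    have : (0 : ℝ) ≤ n := Nat.cast_nonneg n
    linarith [ht.2]
  have hsub : AffineMap.homothety x (t / L) '' D ⊆ Metric.closedBall x t ∩ C := by
    rintro _ ⟨y, ⟨hyC, hyn⟩, rfl⟩
    refine ⟨?_, ?_⟩
    · rw [Metric.mem_closedBall, dist_homothety_center, Real.norm_of_nonneg hε0]
      have hxy : dist x y ≤ L := by
        have h1 := dist_triangle_right x y 0
        rw [Metric.mem_closedBall] at hxM hyn
        linarith [ht.1, ht.2]
      calc t / L * dist x y ≤ t / L * L := by gcongr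
        _ = t := div_mul_cancel₀ _ hL0.ne'
    · rw [AffineMap.homothety_eq_lineMap]
      exact hC.lineMap_mem hxC hyC ⟨hε0, hε1⟩
  calc lam (Metric.closedBall x t)
      = ENNReal.ofReal (t ^ d) * lam (Metric.closedBall 0 1) :=
        Measure.addHaar_closedBall' lam x ht.1.le
    _ = ENNReal.ofReal (L ^ d) * lam (Metric.closedBall 0 1) / lam D *
          (ENNReal.ofReal ((t / L) ^ d) * lam D) := by
        have ht' : t = L * (t / L) := by field_simp
        have e : ENNReal.ofReal (t ^ d) = ENNReal.ofReal (L ^ d) * ENNReal.ofReal ((t / L) ^ d) := by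
          rw [← ENNReal.ofReal_mul (by positivity), ← mul_pow, ← ht']
        rw [e, mul_comm _ (lam D), ← mul_assoc, ENNReal.div_mul_cancel hn hD]
        ring
    _ ≤ _ := by
        gcongr
        rw [← abs_of_nonneg (show 0 ≤ (t / L) ^ d by positivity),
          ← Measure.addHaar_image_homothety lam x]
        exact measure_mono hsub

/-- Pieces that are `lam`-null are also `P`-null, so almost every point lies in a piece of positive
volume. Summing the finitely many constants makes the bound uniform. -/
theorem exists_measure_closedBall_le_of_support (lam P : Measure E) [lam.IsAddHaarMeasure]
    (hPlam : P ≪ lam) {𝒞 : Set (Set E)} (hfin : 𝒞.Finite) (hconv : ∀ C ∈ 𝒞, Convex ℝ C)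
    (hsupp : P.support = ⋃₀ 𝒞) {M : ℝ} (hM : 0 ≤ M) (T : ℝ) :
    ∃ c : ℝ≥0∞, c ≠ ∞ ∧ ∀ᵐ x ∂P, x ∈ Metric.closedBall 0 M → ∀ t ∈ Ioc 0 T,
      lam (Metric.closedBall x t) ≤ c * lam (Metric.closedBall x t ∩ P.support) := by
  have hex : ∀ C ∈ 𝒞, lam C ≠ 0 → ∃ c : ℝ≥0∞, c ≠ ∞ ∧ ∀ x ∈ C ∩ Metric.closedBall 0 M,
      ∀ t ∈ Ioc 0 T, lam (Metric.closedBall x t) ≤ c * lam (Metric.closedBall x t ∩ C) :=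
    fun C hC h0 => exists_measure_closedBall_le_of_convex lam (hconv C hC) h0 hM T
  have hex' : ∀ C, ∃ c : ℝ≥0∞, c ≠ ∞ ∧ (C ∈ 𝒞 → lam C ≠ 0 → ∀ x ∈ C ∩ Metric.closedBall 0 M,
      ∀ t ∈ Ioc 0 T, lam (Metric.closedBall x t) ≤ c * lam (Metric.closedBall x t ∩ C)) := by
    intro C
    by_cases h : C ∈ 𝒞 ∧ lam C ≠ 0
    · obtain ⟨c, hc, hcC⟩ := hex C h.1 h.2
      exact ⟨c, hc, fun _ _ => hcC⟩
    · exact ⟨0, by simp, fun h1 h2 => (h ⟨h1, h2⟩).elim⟩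
  choose c hc hcC using hex'
  refine ⟨∑ C ∈ hfin.toFinset, c C, ENNReal.sum_ne_top.2 fun C _ => hc C, ?_⟩
  have hnull : ∀ᵐ x ∂P, ∀ C ∈ 𝒞, lam C = 0 → x ∉ C := by
    rw [ae_ball_iff hfin.countable]
    intro C _
    by_cases h0 : lam C = 0
    · filter_upwards [measure_eq_zero_iff_ae_notMem.1 (hPlam h0)] with x hx _ using hx
    · exact Filter.Eventually.of_forall fun x h => (h0 h).elim
  filter_upwards [hnull, P.support_mem_ae] with x hx hxs hxM t ht
  rw [hsupp] at hxs ⊢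
  obtain ⟨C, hC, hxC⟩ := hxs
  refine (hcC C hC (fun h0 => hx C hC h0 hxC) x ⟨hxC, hxM⟩ t ht).trans ?_
  gcongr
  · exact Finset.single_le_sum (f := c) (fun _ _ => zero_le) (hfin.mem_toFinset.2 hC)
  · exact subset_sUnion_of_mem hC

end Geometry

/-! ### Optimal grids, densities and dilated laws -/

section Application

variable {E : Type*} [NormedAddCommGroup E] [MeasurableSpace E]

theorem lintegral_norm_rpow_lt_top (P : Measure E) [IsFiniteMeasure P] {r η : ℝ} (hr : 0 < r)
    (hη : 0 < η) (hmoment : Integrable (fun x => ‖x‖ ^ (r + η)) P) :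
    ∫⁻ x, ENNReal.ofReal (‖x‖ ^ r) ∂P < ∞ := by
  have hint : Integrable (fun x : E => 1 + ‖x‖ ^ (r + η)) P := (integrable_const 1).add hmoment
  refine lt_of_le_of_lt (lintegral_mono fun x => ENNReal.ofReal_le_ofReal ?_) hint.lintegral_lt_top
  rcases le_total ‖x‖ 1 with h | h
  · have h1 := Real.rpow_le_one (norm_nonneg x) h hr.le
    have h2 := Real.rpow_nonneg (norm_nonneg x) (r + η)
    linarith
  · have h1 := Real.rpow_le_rpow_of_exponent_le h (show r ≤ r + η by linarith)
    linarith

theorem rpow_add_le_two_rpow_mul {a b r : ℝ} (ha : 0 ≤ a) (hb : 0 ≤ b) (hr : 0 ≤ r) :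
    (a + b) ^ r ≤ 2 ^ r * (a ^ r + b ^ r) := by
  have ha' := Real.rpow_nonneg ha r
  have hb' := Real.rpow_nonneg hb r
  have h2 : (0 : ℝ) ≤ 2 ^ r := Real.rpow_nonneg zero_le_two r
  rcases le_total a b with h | h
  · calc (a + b) ^ r ≤ (2 * b) ^ r := Real.rpow_le_rpow (by linarith) (by linarith) hr
      _ = 2 ^ r * b ^ r := Real.mul_rpow zero_le_two hb
      _ ≤ _ := mul_le_mul_of_nonneg_left (by linarith) h2
  · calc (a + b) ^ r ≤ (2 * a) ^ r := Real.rpow_le_rpow (by linarith) (by linarith) hr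
      _ = 2 ^ r * a ^ r := Real.mul_rpow zero_le_two ha
      _ ≤ _ := mul_le_mul_of_nonneg_left (by linarith) h2

/-- Optimal quantizers stay within bounded distance of the origin. -/
theorem IsOptimalSeq.exists_infDist_zero_le [BorelSpace E] {P : Measure E}
    [IsProbabilityMeasure P] {r : ℝ} (hr : 0 < r) (hmoment : ∫⁻ x, ENNReal.ofReal (‖x‖ ^ r) ∂P < ∞) {α : ℕ → Finset E}
    (hα : IsOptimalSeq P r α) :
    ∃ K : ℝ, 0 ≤ K ∧ ∀ n, 1 ≤ n → Metric.infDist 0 (α n : Set E) ≤ K := by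
  set I := ∫⁻ x, ENNReal.ofReal (‖x‖ ^ r) ∂P with hI
  set J : ℝ≥0∞ := ENNReal.ofReal (2 ^ r) * (I + I) with hJ
  have hJtop : J ≠ ∞ :=
    ENNReal.mul_ne_top ENNReal.ofReal_ne_top (ENNReal.add_ne_top.2 ⟨hmoment.ne, hmoment.ne⟩)
  refine ⟨J.toReal ^ r⁻¹, Real.rpow_nonneg ENNReal.toReal_nonneg _, fun n hn => ?_⟩
  have hdist : distortion P r (α n) ≤ I := by
    rw [(hα n hn).2.2]
    refine (iInf_le_of_le ({0} : Finset E) (iInf_le_of_le (Finset.singleton_nonempty _)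
      (iInf_le_of_le (by simpa using hn) le_rfl))).trans ?_
    simp [distortion, hI]
  set D := Metric.infDist (0 : E) (α n : Set E) with hD
  have hD0 : 0 ≤ D := Metric.infDist_nonneg
  have hm : Measurable fun x : E => ENNReal.ofReal (‖x‖ ^ r) :=
    ENNReal.measurable_ofReal.comp (measurable_norm.pow_const r)
  -- Integrates the `r`-th power of `D ≤ ‖x‖ + d(x, α_n)`; the constant side is unchanged because
  -- `P` has mass 1.
  have hbound : ENNReal.ofReal (D ^ r) ≤ J := by
    calc ENNReal.ofReal (D ^ r) = ∫⁻ _, ENNReal.ofReal (D ^ r) ∂P := by simp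
      _ ≤ ∫⁻ x, ENNReal.ofReal (2 ^ r) * (ENNReal.ofReal (‖x‖ ^ r) +
            ENNReal.ofReal (Metric.infDist x (α n : Set E) ^ r)) ∂P := by
          refine lintegral_mono fun x => ?_
          have h0 : 0 ≤ Metric.infDist x (α n : Set E) := Metric.infDist_nonneg
          rw [← ENNReal.ofReal_add (by positivity) (by positivity),
            ← ENNReal.ofReal_mul (by positivity)]
          refine ENNReal.ofReal_le_ofReal (le_trans ?_
            (rpow_add_le_two_rpow_mul (norm_nonneg x) h0 hr.le))
          refine Real.rpow_le_rpow hD0 ?_ hr.le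
          have := Metric.infDist_le_infDist_add_dist (s := (α n : Set E)) (x := 0) (y := x)
          rw [dist_zero_left] at this
          linarith
      _ = ENNReal.ofReal (2 ^ r) * (I + distortion P r (α n)) := by
          rw [lintegral_const_mul' _ _ ENNReal.ofReal_ne_top, lintegral_add_left hm]
          rfl
      _ ≤ J := by rw [hJ]; gcongr
  have h1 : D ^ r ≤ J.toReal := (ENNReal.ofReal_le_iff_le_toReal hJtop).1 hbound
  calc D = (D ^ r) ^ r⁻¹ := (Real.rpow_rpow_inv hD0 hr.ne').symm
    _ ≤ J.toReal ^ r⁻¹ := Real.rpow_le_rpow (Real.rpow_nonneg hD0 r) h1 (inv_nonneg.2 hr.le)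

/-- Absolute continuity forces `f ≠ 0` at `lam`-almost every point of the support, so there `1 = f *
f⁻¹`. -/
theorem measure_inter_support_le (lam : Measure E) {P : Measure E}
    {f : E → ℝ≥0} (hf : Measurable f) (hP : P = lam.withDensity (fun x => (f x : ℝ≥0∞)))
    (hac : lam.restrict P.support ≪ P) {B : Set E} (hB : MeasurableSet B) :
    lam (B ∩ P.support) ≤ ∫⁻ x in B, (f x : ℝ≥0∞)⁻¹ ∂P := by
  have hfm : Measurable fun x => (f x : ℝ≥0∞) := hf.coe_nnreal_ennreal
  have hZ : MeasurableSet {x | f x = 0} := hf (measurableSet_singleton 0)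
  have hPZ : P {x | f x = 0} = 0 := by
    rw [hP, withDensity_apply _ hZ, setLIntegral_congr_fun hZ (g := fun _ => 0)]
    · simp
    · intro x hx
      simpa using hx
  have hne : ∀ᵐ x ∂(lam.restrict P.support), f x ≠ 0 :=
    ae_iff.2 (hac (by simpa using hPZ))
  calc lam (B ∩ P.support) = ∫⁻ x in B, 1 ∂(lam.restrict P.support) := by
        rw [setLIntegral_one, Measure.restrict_apply hB]
    _ = ∫⁻ x in B, f x * (f x : ℝ≥0∞)⁻¹ ∂(lam.restrict P.support) := by
        refine lintegral_congr_ae (ae_restrict_of_ae ?_)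
        filter_upwards [hne] with x hx
        rw [ENNReal.mul_inv_cancel (by exact_mod_cast hx) ENNReal.coe_ne_top]
    _ ≤ ∫⁻ x in B, f x * (f x : ℝ≥0∞)⁻¹ ∂lam :=
        lintegral_mono' (Measure.restrict_mono le_rfl Measure.restrict_le_self) le_rfl
    _ = ∫⁻ x in B, (f x : ℝ≥0∞)⁻¹ ∂P := by
        conv_rhs => rw [hP]
        rw [setLIntegral_withDensity_eq_setLIntegral_mul _ hfm (by exact hfm.inv) hB]
        rfl

variable [NormedSpace ℝ E] [FiniteDimensional ℝ E] [BorelSpace E]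

theorem map_dilation_addHaar (lam : Measure E) [lam.IsAddHaarMeasure] {θ : ℝ} (hθ : θ ≠ 0)
    (μ : E) : lam.map (fun z => μ + θ • (z - μ)) =
      ENNReal.ofReal |(θ ^ finrank ℝ E)⁻¹| • lam := by
  have h1 : lam.map (fun z => z - μ) = lam := (measurePreserving_sub_right lam μ).map_eq
  have h3 : lam.map (fun z => μ + z) = lam := (measurePreserving_add_left lam μ).map_eq
  have e : (fun z => μ + θ • (z - μ)) = (fun z => μ + z) ∘ (θ • ·) ∘ (fun z => z - μ) := rfl
  rw [e, ← Measure.map_map (by fun_prop) (by fun_prop), ← Measure.map_map (by fun_prop)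
    (by fun_prop), h1, Measure.map_addHaar_smul lam hθ, Measure.map_smul, h3]

/-- On balls, (H1) and admissibility bound the dilated law by a multiple of `P`. -/
theorem exists_setLIntegral_scaledLaw_le (lam : Measure E) [lam.IsAddHaarMeasure] {P : Measure E}
    {f : E → ℝ≥0} (hf : Measurable f) (hP : P = lam.withDensity (fun x => (f x : ℝ≥0∞)))
    {θ : ℝ} {μ : E} (hθ : 0 < θ) (hadm : Admissible lam f θ μ) (h1 : H1 f θ μ) {M : ℝ}
    (hM : 0 < M) :
    ∃ C : ℝ≥0∞, C ≠ ∞ ∧ ∀ G : E → ℝ≥0∞, Measurable G →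
      ∫⁻ x in Metric.closedBall 0 M, G x ∂(scaledLaw P θ μ) ≤
        C * ∫⁻ x in Metric.closedBall 0 M, G x ∂P := by
  obtain ⟨c, hc⟩ := h1 M hM
  set B := Metric.closedBall (0 : E) M
  have hB : MeasurableSet B := Metric.isClosed_closedBall.measurableSet
  -- `T` inverts the map defining `scaledLaw`; substituting `x = T z` produces the quotient in (H1).
  set T : E → E := fun z => μ + θ • (z - μ) with hT
  have hTm : Measurable T := by fun_prop
  set a : ℝ≥0∞ := ENNReal.ofReal |(θ ^ finrank ℝ E)⁻¹| with ha
  have ha0 : a ≠ 0 := by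
    rw [ha, Ne, ENNReal.ofReal_eq_zero, not_le]
    positivity
  have hatop : a ≠ ∞ := ENNReal.ofReal_ne_top
  have hmap : lam.map T = a • lam := map_dilation_addHaar lam hθ.ne' μ
  have hlam : lam = a⁻¹ • lam.map T := by
    rw [hmap, smul_smul, ENNReal.inv_mul_cancel ha0 hatop, one_smul]
  have hfm : Measurable fun x => (f x : ℝ≥0∞) := hf.coe_nnreal_ennreal
  have hφ : Measurable fun x : E => θ⁻¹ • (x - μ) + μ := by fun_prop
  have hφT : ∀ z, θ⁻¹ • (T z - μ) + μ = z := fun z => by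
    simp [hT, smul_smul, inv_mul_cancel₀ hθ.ne']
  -- Admissibility excludes the points where `f z = 0 < f (T z)`, about which (H1) says nothing.
  have hadm' : ∀ᵐ z ∂lam, 0 < f (T z) → 0 < f z := by
    have hae : ∀ᵐ x ∂(lam.map T), x ∈ {y | 0 < f y} →
        x ∈ (fun y => (1 - θ) • μ + θ • y) '' {y | 0 < f y} := by
      rw [hmap]
      exact Measure.ae_smul_measure hadm a
    filter_upwards [ae_of_ae_map hTm.aemeasurable hae] with z hz hfz
    obtain ⟨y, hy, hyz⟩ := hz hfz
    have hyz' : θ • y = θ • z := by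
      have : (1 - θ) • μ + θ • y = μ + θ • (z - μ) := hyz
      rw [sub_smul, one_smul, smul_sub] at this
      have h2 : θ • y = (μ - θ • μ + θ • y) - (μ - θ • μ) := by abel
      rw [h2, this]
      abel
    rwa [smul_right_injective E hθ.ne' hyz'] at hy
  have hle : ∀ᵐ z ∂lam, z ∈ B → (f (T z) : ℝ≥0∞) ≤ c * f z := by
    filter_upwards [hadm'] with z hz hzB
    rcases eq_or_lt_of_le (zero_le (a := f (T z))) with h0 | h0
    · simp [← h0]
    · have hfz := hz h0
      have := hc ⟨z, hzB, rfl⟩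
      rw [indicator_of_mem (by exact hfz)] at this
      exact_mod_cast (div_le_iff₀ hfz).1 this
  refine ⟨a⁻¹ * c, ENNReal.mul_ne_top (ENNReal.inv_ne_top.2 ha0) ENNReal.coe_ne_top,
    fun G hG => ?_⟩
  have hGB : Measurable (B.indicator G) := hG.indicator hB
  calc ∫⁻ x in B, G x ∂(scaledLaw P θ μ)
      = ∫⁻ x, B.indicator G (θ⁻¹ • (x - μ) + μ) ∂P := by
        rw [← lintegral_indicator hB, scaledLaw, lintegral_map hGB hφ]
    _ = ∫⁻ x, f x * B.indicator G (θ⁻¹ • (x - μ) + μ) ∂lam := by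
        rw [hP, lintegral_withDensity_eq_lintegral_mul _ hfm (by exact hGB.comp hφ)]
        rfl
    _ = a⁻¹ * ∫⁻ z, f (T z) * B.indicator G z ∂lam := by
        conv_lhs => rw [hlam]
        rw [lintegral_smul_measure, lintegral_map (by exact hfm.mul (hGB.comp hφ)) hTm]
        simp only [hφT, smul_eq_mul]
    _ ≤ a⁻¹ * ∫⁻ z, c * (f z * B.indicator G z) ∂lam := by
        refine mul_le_mul_right (lintegral_mono_ae ?_) _
        filter_upwards [hle] with z hz
        by_cases hzB : z ∈ B
        · rw [← mul_assoc]
          exact mul_le_mul_left (hz hzB) _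
        · simp [hzB]
    _ = a⁻¹ * c * ∫⁻ x in B, G x ∂P := by
        rw [lintegral_const_mul _ (by exact hfm.mul hGB), ← lintegral_indicator hB, hP,
          lintegral_withDensity_eq_lintegral_mul _ hfm hGB, mul_assoc]
        rfl

/-- The local estimate on a ball suffices: outside, (H2) controls the maximal function once the
factor `b` is small enough. -/
theorem maximalIntegrability_of_local [Nontrivial E] (lam : Measure E) [lam.IsAddHaarMeasure]
    {P : Measure E} [IsProbabilityMeasure P] {f : E → ℝ≥0} (hf : Measurable f)
    (hP : P = lam.withDensity (fun x => (f x : ℝ≥0∞))) {r s η θ : ℝ} {μ : E} (hr : 0 < r)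
    (hs : 0 < s) (hη : 0 < η) (hθ : 0 < θ) (hmoment : Integrable (fun x => ‖x‖ ^ (r + η)) P)
    (hadm : Admissible lam f θ μ) (h1 : H1 f θ μ) (h2 : H2 lam P r s θ μ)
    {α : ℕ → Finset E} (hα : IsOptimalSeq P r α)
    (hloc : ∀ b T M : ℝ, 0 < b → 0 < M → (∀ x ∈ Metric.closedBall (0 : E) M, ∀ n, 1 ≤ n →
      b * Metric.infDist x (α n : Set E) ≤ T) →
      ∫⁻ x in Metric.closedBall 0 M,
        maximalFunction lam P α b x ^ (s / (finrank ℝ E + r)) ∂P < ∞) :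
    MaximalIntegrability lam P r s θ μ α := by
  obtain ⟨b₀, ⟨hb₀, hb₀'⟩, M, hM, hint⟩ := h2
  obtain ⟨K, hK, hKα⟩ :=
    hα.exists_infDist_zero_le hr (lintegral_norm_rpow_lt_top P hr hη hmoment)
  have hdist : ∀ (x : E) n, 1 ≤ n → Metric.infDist x (α n : Set E) ≤ K + ‖x‖ := fun x n hn => by
    have := Metric.infDist_le_infDist_add_dist (s := (α n : Set E)) (x := x) (y := 0)
    rw [dist_zero_right] at this
    linarith [hKα n hn]
  have hp : 0 < s / (finrank ℝ E + r) := by positivity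
  have hKM : 0 < 1 + K / M := by positivity
  -- Chosen so that `b * (K + ‖x‖) ≤ b₀ * ‖x‖` whenever `‖x‖ ≥ M`.
  set b := b₀ / (1 + K / M) with hb
  have hb0 : 0 < b := div_pos hb₀ hKM
  have hbb₀ : b ≤ b₀ := div_le_self hb₀.le (by linarith [div_nonneg hK hM.le])
  have hψ := (measurable_maximalFunction lam P α b).pow_const (s / (finrank ℝ E + r))
  refine ⟨b, ⟨hb0, hbb₀.trans_lt hb₀'⟩, hψ.aestronglyMeasurable, ?_⟩
  rw [hasFiniteIntegral_iff_enorm]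
  simp only [enorm_eq_self]
  have hB : MeasurableSet (Metric.closedBall (0 : E) M) := Metric.isClosed_closedBall.measurableSet
  rw [← lintegral_add_compl _ hB]
  refine ENNReal.add_lt_top.2 ⟨?_, ?_⟩
  · obtain ⟨C, hC, hCle⟩ := exists_setLIntegral_scaledLaw_le lam hf hP hθ hadm h1 hM
    refine (hCle _ hψ).trans_lt (ENNReal.mul_lt_top hC.lt_top
      (hloc b (b * (K + M)) M hb0 hM fun x hx n hn => ?_))
    have hx' : ‖x‖ ≤ M := by simpa using hx
    exact mul_le_mul_of_nonneg_left ((hdist x n hn).trans (by linarith)) hb0.le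
  · refine lt_of_le_of_lt (setLIntegral_mono' hB.compl fun x hx => ?_) hint
    have hx' : M ≤ ‖x‖ := by
      have : ¬ ‖x‖ ≤ M := by simpa using hx
      linarith
    refine ENNReal.rpow_le_rpow (iSup₂_le fun n hn => ?_) hp.le
    have ht0 : 0 ≤ b * Metric.infDist x (α n : Set E) := mul_nonneg hb0.le Metric.infDist_nonneg
    rcases ht0.eq_or_lt with h0 | hpos
    · rw [← h0, ballRatio_zero]
      exact zero_le
    · refine le_iSup₂_of_le _ ⟨hpos, ?_⟩ le_rfl
      calc b * Metric.infDist x (α n : Set E) ≤ b * (K + ‖x‖) :=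
            mul_le_mul_of_nonneg_left (hdist x n hn) hb0.le
        _ ≤ b * ((1 + K / M) * ‖x‖) := by
            refine mul_le_mul_of_nonneg_left ?_ hb0.le
            have : K / M * M ≤ K / M * ‖x‖ :=
              mul_le_mul_of_nonneg_left hx' (div_nonneg hK hM.le)
            rw [div_mul_cancel₀ _ hM.ne'] at this
            linarith
        _ = b₀ * ‖x‖ := by rw [← mul_assoc, hb, div_mul_cancel₀ _ hKM.ne']
        _ ≤ 2 * b₀ * ‖x‖ := by nlinarith [mul_nonneg hb₀.le (norm_nonneg x)]

end Application

end Quantization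

end

/-! ### The two ranges of `s` -/

theorem corollary3p1
    {E : Type*} [NormedAddCommGroup E] [NormedSpace ℝ E] [FiniteDimensional ℝ E] [Nontrivial E]
    [MeasurableSpace E] [BorelSpace E]
    (lam : Measure E) [lam.IsAddHaarMeasure]
    (P : Measure E) [IsProbabilityMeasure P]
    (f : E → ℝ≥0) (hf : Measurable f) (hP : P = lam.withDensity (fun x => (f x : ℝ≥0∞)))
    (r s η θ : ℝ) (μ : E) (hr : 0 < r) (hs : 0 < s) (hη : 0 < η) (hθ : 0 < θ)
    (hmoment : Integrable (fun x => ‖x‖ ^ (r + η)) P)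
    (hadm : Quantization.Admissible lam f θ μ)
    (h1 : Quantization.H1 f θ μ) (h2 : Quantization.H2 lam P r s θ μ)
    (α : ℕ → Finset E) (hα : Quantization.IsOptimalSeq P r α) :
    (s < r + finrank ℝ E → Quantization.MaximalIntegrability lam P r s θ μ α) ∧
    (r + finrank ℝ E < s → Quantization.H3 lam P →
      LocallyIntegrable (fun x => (f x : ℝ≥0∞) ^ (-(s / (r + finrank ℝ E)))) P →
      Quantization.MaximalIntegrability lam P r s θ μ α) := by
  have hd : (0 : ℝ) < finrank ℝ E + r := by positivity
  refine ⟨fun hsr => ?_, fun hsr h3 hfloc => ?_⟩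
  · refine Quantization.maximalIntegrability_of_local lam hf hP hr hs hη hθ hmoment hadm h1 h2 hα
      fun b T M hb _ hT => ?_
    exact Quantization.lintegral_maximalFunction_lt_top_of_lt_one lam P hb.le hT (div_pos hs hd)
      ((div_lt_one hd).2 (by linarith))
  · refine Quantization.maximalIntegrability_of_local lam hf hP hr hs hη hθ hmoment hadm h1 h2 hα
      fun b T M hb hM hT => ?_
    obtain ⟨hac, 𝒞, hfin, h𝒞, hsupp⟩ := h3
    have hPlam : P ≪ lam := hP ▸ withDensity_absolutelyContinuous _ _
    obtain ⟨c, hc, hcle⟩ := Quantization.exists_measure_closedBall_le_of_support lam P hPlam hfin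
      (fun C hC => (h𝒞 C hC).2) hsupp hM.le T
    have hfm : Measurable fun x => (f x : ℝ≥0∞)⁻¹ := hf.coe_nnreal_ennreal.inv
    have hp : 0 < s / (finrank ℝ E + r) := div_pos hs hd
    -- The dominating function is `h = c / f`; its `p`-th power is locally integrable by the
    -- assumption on `f`.
    refine Quantization.lintegral_maximalFunction_lt_top_of_one_lt lam P hb.le hT
      ((one_lt_div hd).2 (by linarith)) (hfm.const_mul c) ?_ ?_
    · have hfin := (hfloc.integrableOn_isCompact
        (isCompact_closedBall (0 : E) (M + T))).hasFiniteIntegral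
      rw [hasFiniteIntegral_iff_enorm] at hfin
      simp only [enorm_eq_self] at hfin
      simp_rw [ENNReal.mul_rpow_of_nonneg _ _ hp.le, ENNReal.inv_rpow, ← ENNReal.rpow_neg]
      rw [lintegral_const_mul' _ _ (ENNReal.rpow_lt_top_of_nonneg hp.le hc).ne]
      rw [add_comm r] at hfin
      exact ENNReal.mul_lt_top (ENNReal.rpow_lt_top_of_nonneg hp.le hc) hfin
    · filter_upwards [hcle] with x hx hxM t ht
      refine (hx hxM t ht).trans ?_
      rw [lintegral_const_mul _ hfm]
      exact mul_le_mul_right (Quantization.measure_inter_support_le lam hf hP hac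
        Metric.isClosed_closedBall.measurableSet) _
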